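/- Let $r\ge 1$ be an integer and let $p_1,\dots,p_r$ be distinct primes. For an integer $n\ge 1$ let $\kappa(n)$ denote its squarefree kernel, i.e. the product of the distinct primes dividing $n$ (with $\kappa(1)=1$). Two positive integers $n,m$ are called exponentially coprime if they have the same prime factors and, for each prime $p$ dividing them, the exponents of $p$ in the prime factorizations of $n$ and of $m$ are coprime. For real $x$ let $N(p_1,\dots,p_r;x)$ be the number of positive integers $n\le x$ with $\kappa(n)=p_1\cdots p_r$, and let $P^{(e)}(p_1,\dots,p_r;x)$ be the number of ordered pairs $(n,m)$ of exponentially coprime integers with $n,m\le x$ and $\kappa(n)=\kappa(m)=p_1\cdots p_r$. Then $$\lim_{x\to\infty}\frac{P^{(e)}(p_1,\dots,p_r;x)}{N(p_1,\dots,p_r;x)^2}=\zeta(2)^{-r},$$ where $\zeta$ is the Riemann zeta function. That is, among pairs of positive integers whose set of prime divisors is $\{p_1,\dots,p_r\}$, the exponentially coprime pairs have asymptotic density $\zeta(2)^{-r}$. -/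

import Mathlib

open Filter Topology

/-- Two positive integers `n`, `m` are exponentially coprime if they have the same prime factors
and, for every such prime `p`, the exponents of `p` in `n` and in `m` are coprime. In particular
`1` and `1` are exponentially coprime, while `1` and `m > 1` are not. -/
def ExponentiallyCoprime (n m : ℕ) : Prop :=
  0 < n ∧ 0 < m ∧ n.primeFactors = m.primeFactors ∧
    ∀ p ∈ n.primeFactors, Nat.Coprime (n.factorization p) (m.factorization p)

instance (n m : ℕ) : Decidable (ExponentiallyCoprime n m) := by
  unfold ExponentiallyCoprime
  infer_instance

/-- The finite set of positive integers `n ≤ x` whose squarefree kernel is `∏ i, p i`. -/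
noncomputable def kernelSet {r : ℕ} (p : Fin r → ℕ) (x : ℝ) : Finset ℕ :=
  (Finset.Icc 1 ⌊x⌋₊).filter fun n => UniqueFactorizationMonoid.radical n = ∏ i, p i

/-- `N(p₁, …, p_r; x)`: the number of positive integers `n ≤ x` with kernel `p₁ ⋯ p_r`. -/
noncomputable def kernelCount {r : ℕ} (p : Fin r → ℕ) (x : ℝ) : ℕ :=
  (kernelSet p x).card

/-- `P⁽ᵉ⁾(p₁, …, p_r; x)`: the number of ordered pairs `(n, m)` of exponentially coprime integers
`n, m ≤ x`, both with kernel `p₁ ⋯ p_r`. -/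
noncomputable def expCoprimePairCount {r : ℕ} (p : Fin r → ℕ) (x : ℝ) : ℕ :=
  ((kernelSet p x ×ˢ kernelSet p x).filter fun q => ExponentiallyCoprime q.1 q.2).card

/-!
Writing `n = ∏ pᵢ ^ aᵢ`, the integers `n ≤ x` with kernel `p₁ ⋯ p_r` correspond to the vectors `a` of
positive integers with `∑ aᵢ log pᵢ ≤ log x`, the lattice points of a simplex, and exponential
coprimality of `n` and `m` becomes coprimality of the exponents coordinate by coordinate. So the
claim is about lattice points `a`, `b` of a simplex `∑ aᵢ wᵢ ≤ T` as `T → ∞`, for any weights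
`wᵢ > 0`.

Let `A` be the number of points and, for a vector `d` of positive integers, `A_d` the number of those
with `dᵢ ∣ aᵢ` for all `i`. Möbius inversion in each coordinate gives
`#{(a, b) : gcd (aᵢ, bᵢ) = 1 for all i} = ∑_d (∏ μ(dᵢ)) A_d ^ 2` (`hasSum_card_coprime_pairs`).
The boxes `∏ (aᵢ - dᵢ, aᵢ]` with corners `a` divisible by `d` are disjoint and lie in the simplex,
whence `A_d ∏ dᵢ ≤ A` (`card_multiplePoints_mul_le`); conversely, rounding down to multiples of `d`
shows that `A` exceeds `A_d ∏ dᵢ` by at most the number of points with some `aᵢ < dᵢ`, which is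
`O(T ^ (r - 1))`, whereas `A` is at least of order `T ^ r`. Hence `A_d / A → ∏ dᵢ⁻¹`
(`tendsto_card_multiplePoints_div`), and since `(A_d / A) ^ 2` is at most `∏ dᵢ⁻²`, which is summable
over `d`, dominated convergence yields the limit
`∑_d ∏ μ(dᵢ) dᵢ⁻² = (∑ μ(d) d⁻²) ^ r = ζ(2) ^ (-r)`.
No volume computation is needed.
-/

/-! ### Lattice points of a simplex -/

section LatticePoints

variable {ι : Type*} [Fintype ι] [DecidableEq ι]

/-- The vectors `a` of positive integers with `∑ i, a i * w i ≤ T`. The box in which they are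
selected serves only to make the set finite: for `w > 0` it imposes no further condition, see
`mem_simplexPoints`. -/
noncomputable def simplexPoints (w : ι → ℝ) (T : ℝ) : Finset (ι → ℕ) :=
  (Fintype.piFinset fun i => Finset.Icc 1 ⌊T / w i⌋₊).filter fun a => ∑ i, a i * w i ≤ T

/-- The points `a` of `simplexPoints w T` such that `d i` divides `a i` for every `i`. -/
noncomputable def multiplePoints (w : ι → ℝ) (T : ℝ) (d : ι → ℕ) : Finset (ι → ℕ) :=
  (simplexPoints w T).filter fun a => ∀ i, d i ∣ a i

theorem mem_simplexPoints {w : ι → ℝ} (hw : ∀ i, 0 < w i) {T : ℝ} {a : ι → ℕ} :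
    a ∈ simplexPoints w T ↔ (∀ i, 1 ≤ a i) ∧ ∑ i, a i * w i ≤ T := by
  simp only [simplexPoints, Finset.mem_filter, Fintype.mem_piFinset, Finset.mem_Icc]
  refine ⟨fun h => ⟨fun i => (h.1 i).1, h.2⟩, fun h => ⟨fun i => ⟨h.1 i, ?_⟩, h.2⟩⟩
  refine Nat.le_floor ((le_div_iff₀ (hw i)).2 (le_trans ?_ h.2))
  exact Finset.single_le_sum (f := fun i => (a i : ℝ) * w i)
    (fun j _ => mul_nonneg (Nat.cast_nonneg _) (hw j).le) (Finset.mem_univ i)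

/-- Each point `a` divisible by `d` owns the box of points `a - j` with `0 ≤ j i < d i`; these boxes
are disjoint and stay in the simplex. -/
theorem card_multiplePoints_mul_le {w : ι → ℝ} (hw : ∀ i, 0 < w i) (T : ℝ) (d : ι → ℕ) :
    (multiplePoints w T d).card * ∏ i, d i ≤ (simplexPoints w T).card := by
  have hcard : ∏ i, d i = (Fintype.piFinset fun i => Finset.range (d i)).card := by simp
  rw [hcard, ← Finset.card_product]
  refine Finset.card_le_card_of_injOn (fun q i => q.1 i - q.2 i) ?_ ?_
  · rintro ⟨a, j⟩ h
    simp only [multiplePoints, Finset.coe_product, Set.mem_prod, Finset.mem_coe, Finset.mem_filter,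
      mem_simplexPoints hw, Fintype.mem_piFinset, Finset.mem_range] at h ⊢
    obtain ⟨⟨⟨h1, hT⟩, hd⟩, hj⟩ := h
    refine ⟨fun i => ?_, le_trans (Finset.sum_le_sum fun i _ => ?_) hT⟩
    · have := Nat.le_of_dvd (h1 i) (hd i)
      have := hj i
      omega
    · exact mul_le_mul_of_nonneg_right (by exact_mod_cast Nat.sub_le _ _) (hw i).le
  · rintro ⟨a, j⟩ h ⟨b, k⟩ h' heq
    simp only [multiplePoints, Finset.coe_product, Set.mem_prod, Finset.mem_coe, Finset.mem_filter,
      mem_simplexPoints hw, Fintype.mem_piFinset, Finset.mem_range] at h h'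
    obtain ⟨⟨⟨h1, -⟩, hd⟩, hj⟩ := h
    obtain ⟨⟨⟨h1', -⟩, hd'⟩, hk⟩ := h'
    have key : ∀ i, a i = b i ∧ j i = k i := by
      intro i
      have e : a i - j i = b i - k i := congrFun heq i
      have l1 := Nat.le_of_dvd (h1 i) (hd i)
      have l2 := Nat.le_of_dvd (h1' i) (hd' i)
      have := hj i
      have := hk i
      have e' : a i + k i = b i + j i := by omega
      have hmod : j i = k i := by
        have := congrArg (· % d i) e'
        simpa [Nat.add_mod, Nat.mod_eq_zero_of_dvd (hd i), Nat.mod_eq_zero_of_dvd (hd' i),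
          Nat.mod_eq_of_lt (hj i), Nat.mod_eq_of_lt (hk i), eq_comm] using this
      omega
    exact Prod.ext (funext fun i => (key i).1) (funext fun i => (key i).2)

/-- Points with `d i ≤ a i` for all `i` are recovered from their rounding down to a multiple of `d`
and their remainders; the points with `a i < d i` for some `i` lie in a thin box. -/
theorem card_simplexPoints_le {w : ι → ℝ} (hw : ∀ i, 0 < w i) {T : ℝ} {d : ι → ℕ}
    (hd : ∀ i, 0 < d i) :
    (simplexPoints w T).card ≤ (multiplePoints w T d).card * ∏ i, d i
      + ∑ i, d i * ∏ j ∈ Finset.univ.erase i, ⌊T / w j⌋₊ := by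
  classical
  rw [← Finset.card_filter_add_card_filter_not (fun a : ι → ℕ => ∀ i, d i ≤ a i)]
  refine add_le_add ?_ ?_
  · have hcard : ∏ i, d i = (Fintype.piFinset fun i => Finset.range (d i)).card := by simp
    rw [hcard, ← Finset.card_product]
    refine Finset.card_le_card_of_injOn (fun a => (fun i => d i * (a i / d i), fun i => a i % d i))
      ?_ ?_
    · intro a h
      simp only [multiplePoints, Finset.coe_product, Set.mem_prod, Finset.mem_coe,
        Finset.mem_filter, mem_simplexPoints hw, Fintype.mem_piFinset, Finset.mem_range] at h ⊢
      obtain ⟨⟨-, hT⟩, hle⟩ := h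
      refine ⟨⟨⟨fun i => ?_, le_trans (Finset.sum_le_sum fun i _ => ?_) hT⟩,
        fun i => dvd_mul_right _ _⟩, fun i => Nat.mod_lt _ (hd i)⟩
      · exact Nat.mul_pos (hd i) (Nat.div_pos (hle i) (hd i))
      · exact mul_le_mul_of_nonneg_right (by exact_mod_cast Nat.mul_div_le _ _) (hw i).le
    · intro a _ b _ heq
      funext i
      rw [← Nat.div_add_mod (a i) (d i), ← Nat.div_add_mod (b i) (d i)]
      have h1 : d i * (a i / d i) = d i * (b i / d i) := congrFun (congrArg Prod.fst heq) i
      have h2 : a i % d i = b i % d i := congrFun (congrArg Prod.snd heq) i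
      rw [h1, h2]
  · have hsub : (simplexPoints w T).filter (fun a => ¬ ∀ i, d i ≤ a i) ⊆
        Finset.univ.biUnion fun i => Fintype.piFinset
          (Function.update (fun j => Finset.Icc 1 ⌊T / w j⌋₊) i (Finset.range (d i))) := by
      intro a h
      simp only [simplexPoints, Finset.mem_filter, not_forall, not_le, Fintype.mem_piFinset] at h
      obtain ⟨⟨hbox, -⟩, i, hi⟩ := h
      simp only [Finset.mem_biUnion, Finset.mem_univ, true_and, Fintype.mem_piFinset]
      refine ⟨i, fun j => ?_⟩
      rcases eq_or_ne j i with rfl | hj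
      · simpa using hi
      · simpa [Function.update_of_ne hj] using hbox j
    refine (Finset.card_le_card hsub).trans (Finset.card_biUnion_le.trans
      (Finset.sum_le_sum fun i _ => le_of_eq ?_))
    rw [Fintype.card_piFinset, ← Finset.mul_prod_erase _ _ (Finset.mem_univ i)]
    congr 1
    · simp
    · refine Finset.prod_congr rfl fun j hj => ?_
      simp [Function.update_of_ne (Finset.ne_of_mem_erase hj)]

/-- The simplex contains the box in which every coordinate uses at most the share
`T / Fintype.card ι` of the total weight. -/
theorem prod_floor_le_card_simplexPoints {w : ι → ℝ} (hw : ∀ i, 0 < w i) {T : ℝ} (hT : 0 ≤ T) :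
    ∏ i, ⌊T / (Fintype.card ι * w i)⌋₊ ≤ (simplexPoints w T).card := by
  rcases isEmpty_or_nonempty ι with _ | _
  · simp [simplexPoints, hT]
  have hc : (0 : ℝ) < Fintype.card ι := by exact_mod_cast Fintype.card_pos
  have hcard : ∏ i, ⌊T / (Fintype.card ι * w i)⌋₊
      = (Fintype.piFinset fun i => Finset.Icc 1 ⌊T / (Fintype.card ι * w i)⌋₊).card := by simp
  rw [hcard]
  refine Finset.card_le_card fun a ha => ?_
  simp only [Fintype.mem_piFinset, Finset.mem_Icc] at ha
  refine (mem_simplexPoints hw).2 ⟨fun i => (ha i).1, ?_⟩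
  calc ∑ i, (a i : ℝ) * w i ≤ ∑ _i : ι, T / Fintype.card ι := by
        refine Finset.sum_le_sum fun i _ => ?_
        have h := (Nat.le_floor_iff (div_nonneg hT (mul_pos hc (hw i)).le)).1 (ha i).2
        rwa [← div_div, le_div_iff₀ (hw i)] at h
    _ = T := by simp; field_simp

theorem eventually_mul_pow_le_card_simplexPoints {w : ι → ℝ} (hw : ∀ i, 0 < w i) :
    ∃ c > 0, ∀ᶠ T in atTop, c * T ^ Fintype.card ι ≤ ((simplexPoints w T).card : ℝ) := by
  rcases isEmpty_or_nonempty ι with _ | _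
  · refine ⟨1, one_pos, (eventually_ge_atTop 0).mono fun T hT => ?_⟩
    simp [simplexPoints, hT]
  have hc : (0 : ℝ) < Fintype.card ι := by exact_mod_cast Fintype.card_pos
  refine ⟨∏ i, (2 * (Fintype.card ι * w i))⁻¹,
    Finset.prod_pos fun i _ => by have := hw i; positivity, ?_⟩
  have hev : ∀ᶠ T : ℝ in atTop, ∀ i, (Fintype.card ι * w i) ≤ T :=
    eventually_all.2 fun i => eventually_ge_atTop _
  filter_upwards [hev, eventually_ge_atTop 0] with T hT h0
  refine le_trans ?_ (Nat.cast_le.2 (prod_floor_le_card_simplexPoints hw h0))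
  rw [Nat.cast_prod, Fintype.card, ← Finset.prod_const, ← Finset.prod_mul_distrib]
  refine Finset.prod_le_prod (fun i _ => by have := hw i; positivity) fun i _ => ?_
  have hpos : 0 < Fintype.card ι * w i := mul_pos hc (hw i)
  have h1 : 1 ≤ T / (Fintype.card ι * w i) := (one_le_div hpos).2 (hT i)
  have h2 := Nat.lt_floor_add_one (T / (Fintype.card ι * w i))
  have h3 : (1 : ℝ) ≤ ⌊T / (Fintype.card ι * w i)⌋₊ := by
    exact_mod_cast Nat.le_floor (by simpa using h1)
  -- The floor of a real number that is at least `1` is at least half of that number.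
  have h4 : (2 * (Fintype.card ι * w i))⁻¹ * T = T / (Fintype.card ι * w i) / 2 := by
    field_simp
  change (2 * (Fintype.card ι * w i))⁻¹ * T ≤ ⌊T / (Fintype.card ι * w i)⌋₊
  rw [h4]
  linarith

/-- The points near a face of the simplex have a negligible proportion: their number has order at
most `T ^ (card ι - 1)`. -/
theorem tendsto_boundary_div_card {w : ι → ℝ} (hw : ∀ i, 0 < w i) (i : ι) :
    Tendsto (fun T => ((∏ j ∈ Finset.univ.erase i, ⌊T / w j⌋₊ : ℕ) : ℝ)
      / ((simplexPoints w T).card : ℝ)) atTop (𝓝 0) := by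
  obtain ⟨c, hc, hev⟩ := eventually_mul_pow_le_card_simplexPoints hw
  set K : ℝ := ∏ j ∈ Finset.univ.erase i, (w j)⁻¹ with hK
  have hK0 : 0 ≤ K := Finset.prod_nonneg fun j _ => (inv_pos.2 (hw j)).le
  have hlim : Tendsto (fun T : ℝ => K / c * T⁻¹) atTop (𝓝 0) := by
    simpa using tendsto_inv_atTop_zero.const_mul (K / c)
  refine squeeze_zero' (Eventually.of_forall fun T => by positivity) ?_ hlim
  filter_upwards [hev, eventually_gt_atTop 0] with T hT h0
  have hcard : Fintype.card ι = (Finset.univ.erase i).card + 1 := by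
    rw [Finset.card_erase_add_one (Finset.mem_univ i)]; rfl
  have hnum : ((∏ j ∈ Finset.univ.erase i, ⌊T / w j⌋₊ : ℕ) : ℝ)
      ≤ K * T ^ (Finset.univ.erase i).card := by
    rw [Nat.cast_prod, hK, ← Finset.prod_const, ← Finset.prod_mul_distrib]
    refine Finset.prod_le_prod (fun j _ => by positivity) fun j _ => ?_
    rw [inv_mul_eq_div]
    exact Nat.floor_le (div_nonneg h0.le (hw j).le)
  calc _ ≤ K * T ^ (Finset.univ.erase i).card / (c * T ^ Fintype.card ι) := by gcongr
    _ = K / c * T⁻¹ := by rw [hcard, pow_succ]; field_simp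

theorem tendsto_card_multiplePoints_div {w : ι → ℝ} (hw : ∀ i, 0 < w i) {d : ι → ℕ}
    (hd : ∀ i, 0 < d i) :
    Tendsto (fun T => ((multiplePoints w T d).card : ℝ) / ((simplexPoints w T).card : ℝ))
      atTop (𝓝 (∏ i, (d i : ℝ)⁻¹)) := by
  obtain ⟨c, hc, hev⟩ := eventually_mul_pow_le_card_simplexPoints hw
  have hD : (0 : ℝ) < ∏ i, (d i : ℝ) := Finset.prod_pos fun i _ => by exact_mod_cast hd i
  have hlow : Tendsto (fun T => (1 - ∑ i, (d i : ℝ) *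
      (((∏ j ∈ Finset.univ.erase i, ⌊T / w j⌋₊ : ℕ) : ℝ) / ((simplexPoints w T).card : ℝ)))
      * (∏ i, (d i : ℝ))⁻¹) atTop (𝓝 (∏ i, (d i : ℝ)⁻¹)) := by
    have h := ((tendsto_finsetSum Finset.univ fun i _ =>
      (tendsto_boundary_div_card hw i).const_mul (d i : ℝ)).const_sub 1).mul_const
      (∏ i, (d i : ℝ))⁻¹
    simpa [Finset.prod_inv_distrib] using h
  refine tendsto_of_tendsto_of_tendsto_of_le_of_le' hlow tendsto_const_nhds ?_ ?_
  · filter_upwards [hev, eventually_gt_atTop 0] with T hT h0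
    have hS : (0 : ℝ) < (simplexPoints w T).card := lt_of_lt_of_le (by positivity) hT
    have h : ((simplexPoints w T).card : ℝ) ≤ (multiplePoints w T d).card * ∏ i, (d i : ℝ)
        + ∑ i, (d i : ℝ) * ((∏ j ∈ Finset.univ.erase i, ⌊T / w j⌋₊ : ℕ) : ℝ) := by
      exact_mod_cast card_simplexPoints_le (T := T) hw hd
    rw [← div_eq_mul_inv, div_le_div_iff₀ hD hS]
    simp_rw [← mul_div_assoc]
    rw [← Finset.sum_div, sub_mul, div_mul_cancel₀ _ hS.ne']
    linarith
  · filter_upwards [hev, eventually_gt_atTop 0] with T hT h0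
    have hS : (0 : ℝ) < (simplexPoints w T).card := lt_of_lt_of_le (by positivity) hT
    have h : ((multiplePoints w T d).card : ℝ) * ∏ i, (d i : ℝ) ≤ (simplexPoints w T).card := by
      exact_mod_cast card_multiplePoints_mul_le hw T d
    rw [Finset.prod_inv_distrib, ← one_div, div_le_div_iff₀ hS hD]
    linarith

end LatticePoints

/-! ### Möbius inversion in each coordinate -/

theorem hasSum_mul_of_summable_norm {α β : Type*} {f : α → ℝ} {g : β → ℝ} {c : ℝ}
    (hf : Summable fun k => ‖f k‖) (hg : Summable fun k => ‖g k‖) (hc : HasSum g c) :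
    (Summable fun q : α × β => ‖f q.1 * g q.2‖) ∧
      HasSum (fun q : α × β => f q.1 * g q.2) ((∑' k, f k) * c) := by
  have hn := Summable.mul_norm hf hg
  exact ⟨hn, hf.of_norm.hasSum.mul hc hn.of_norm⟩

/-- A product of `r` absolutely convergent series is the sum, over all `r`-tuples of indices, of the
products of terms. -/
theorem hasSum_pi_prod {α : Type*} {r : ℕ} {f : Fin r → α → ℝ}
    (hf : ∀ i, Summable fun k => ‖f i k‖) :
    (Summable fun d : Fin r → α => ‖∏ i, f i (d i)‖) ∧
      HasSum (fun d : Fin r → α => ∏ i, f i (d i)) (∏ i, ∑' k, f i k) := by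
  induction r with
  | zero =>
    have h := hasSum_unique fun _ : Fin 0 → α => (1 : ℝ)
    simp only [Finset.univ_eq_empty, Finset.prod_empty]
    exact ⟨h.summable.norm, h⟩
  | succ r ih =>
    obtain ⟨ih1, ih2⟩ := ih (f := fun i => f i.succ) fun i => hf i.succ
    have h := hasSum_mul_of_summable_norm (hf 0) ih1 ih2
    let e : α × (Fin r → α) ≃ (Fin (r + 1) → α) := Fin.consEquiv fun _ => α
    have he : ∀ q, ∏ i, f i (e q i) = f 0 q.1 * ∏ i, f i.succ (q.2 i) := fun q => by
      simp [e, Fin.consEquiv, Fin.prod_univ_succ]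
    rw [← e.summable_iff, ← e.hasSum_iff, Fin.prod_univ_succ]
    simp only [Function.comp_def, he]
    exact h

open ArithmeticFunction in
theorem sum_divisors_moebius (n : ℕ) :
    ∑ d ∈ n.divisors, moebius d = if n = 1 then 1 else 0 := by
  rw [← coe_mul_zeta_apply, moebius_mul_coe_zeta, one_apply]

open ArithmeticFunction in
/-- The coprimality indicator as a Möbius sum over the common divisors. It is written over all of `ℕ`,
so that it can be multiplied out with `hasSum_pi_prod`. -/
theorem hasSum_moebius_common_divisors {a : ℕ} (ha : 1 ≤ a) (b : ℕ) :
    HasSum (fun d : ℕ => if d ∣ a ∧ d ∣ b then (moebius d : ℝ) else 0)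
      (if a.Coprime b then 1 else 0) := by
  have hg : a.gcd b ≠ 0 := (Nat.gcd_pos_of_pos_left b ha).ne'
  have h : HasSum (fun d : ℕ => if d ∣ a ∧ d ∣ b then (moebius d : ℝ) else 0)
      (∑ d ∈ (a.gcd b).divisors, if d ∣ a ∧ d ∣ b then (moebius d : ℝ) else 0) :=
    hasSum_sum_of_ne_finset_zero fun d hd =>
      if_neg fun hab => hd (Nat.mem_divisors.2 ⟨Nat.dvd_gcd hab.1 hab.2, hg⟩)
  convert h using 1
  rw [Finset.sum_congr rfl fun d hd => if_pos (Nat.dvd_gcd_iff.1 (Nat.dvd_of_mem_divisors hd)),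
    ← Int.cast_sum, sum_divisors_moebius]
  simp [Nat.Coprime]

open ArithmeticFunction in
/-- The number of coordinatewise coprime pairs of points, as a Möbius sum over vectors `d`. Only
finitely many terms are nonzero. -/
theorem hasSum_card_coprime_pairs {r : ℕ} {w : Fin r → ℝ} (hw : ∀ i, 0 < w i) (T : ℝ) :
    HasSum (fun d : Fin r → ℕ => (∏ i, (moebius (d i) : ℝ)) * ((multiplePoints w T d).card : ℝ) ^ 2)
      (((simplexPoints w T ×ˢ simplexPoints w T).filter
        fun q => ∀ i, (q.1 i).Coprime (q.2 i)).card : ℝ) := by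
  have hpair : ∀ q ∈ simplexPoints w T ×ˢ simplexPoints w T,
      HasSum (fun d : Fin r → ℕ =>
          if ∀ i, d i ∣ q.1 i ∧ d i ∣ q.2 i then ∏ i, (moebius (d i) : ℝ) else 0)
        (if ∀ i, (q.1 i).Coprime (q.2 i) then 1 else 0) := by
    intro q hq
    have h1 := ((mem_simplexPoints hw).1 (Finset.mem_product.1 hq).1).1
    have hs := fun i => hasSum_moebius_common_divisors (h1 i) (q.2 i)
    have h := (hasSum_pi_prod fun i => (hs i).summable.norm).2
    simp_rw [(hs _).tsum_eq, Finset.prod_ite_zero] at h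
    simpa using h
  have h := hasSum_sum hpair
  rw [Finset.sum_boole] at h
  convert h using 2 with d
  have hprod : (multiplePoints w T d ×ˢ multiplePoints w T d).card
      = ((simplexPoints w T ×ˢ simplexPoints w T).filter
          fun q => ∀ i, d i ∣ q.1 i ∧ d i ∣ q.2 i).card := by
    rw [multiplePoints, ← Finset.filter_product]
    exact congrArg Finset.card (Finset.ext fun q => by simp only [Finset.mem_filter, forall_and])
  rw [pow_two, ← Nat.cast_mul, ← Finset.card_product, hprod]
  rw [← Finset.sum_filter]
  simp [mul_comm]

/-! ### The density of coprime pairs -/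

open ArithmeticFunction in
/-- Dominated convergence for the Möbius sum of `hasSum_card_coprime_pairs`. -/
theorem tendsto_coprime_pairs_density {r : ℕ} {w : Fin r → ℝ} (hw : ∀ i, 0 < w i) :
    Tendsto (fun T => (((simplexPoints w T ×ˢ simplexPoints w T).filter
        fun q => ∀ i, (q.1 i).Coprime (q.2 i)).card : ℝ) / ((simplexPoints w T).card : ℝ) ^ 2)
      atTop (𝓝 ((∑' d : ℕ, (moebius d : ℝ) * ((d : ℝ) ^ 2)⁻¹) ^ r)) := by
  have hle : ∀ d : ℕ, ‖(moebius d : ℝ)‖ ≤ 1 := fun d => by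
    rw [Real.norm_eq_abs]; exact_mod_cast abs_moebius_le_one (n := d)
  have hsq : Summable fun d : ℕ => ((d : ℝ) ^ 2)⁻¹ :=
    Real.summable_nat_pow_inv.2 one_lt_two
  have hμ : Summable fun d : ℕ => ‖(moebius d : ℝ) * ((d : ℝ) ^ 2)⁻¹‖ :=
    hsq.of_nonneg_of_le (fun _ => norm_nonneg _) fun d => by
      rw [norm_mul, Real.norm_of_nonneg (r := ((d : ℝ) ^ 2)⁻¹) (by positivity)]
      exact mul_le_of_le_one_left (by positivity) (hle d)
  have hlim : ∑' d : Fin r → ℕ, ∏ i, ((moebius (d i) : ℝ) * ((d i : ℝ) ^ 2)⁻¹)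
      = (∑' d : ℕ, (moebius d : ℝ) * ((d : ℝ) ^ 2)⁻¹) ^ r := by
    rw [(hasSum_pi_prod fun _ : Fin r => hμ).2.tsum_eq]; simp
  rw [← hlim]
  have hbound : Summable fun d : Fin r → ℕ => ∏ i, ((d i : ℝ) ^ 2)⁻¹ :=
    (hasSum_pi_prod fun _ : Fin r => hsq.norm).2.summable
  have hcount : ∀ T, (((simplexPoints w T ×ˢ simplexPoints w T).filter
        fun q => ∀ i, (q.1 i).Coprime (q.2 i)).card : ℝ) / ((simplexPoints w T).card : ℝ) ^ 2
      = ∑' d : Fin r → ℕ, (∏ i, (moebius (d i) : ℝ)) *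
        (((multiplePoints w T d).card : ℝ) / ((simplexPoints w T).card : ℝ)) ^ 2 := fun T => by
    rw [← (hasSum_card_coprime_pairs hw T).tsum_eq, ← tsum_div_const]
    simp_rw [div_pow, mul_div_assoc]
  simp_rw [hcount]
  -- Vectors `d` with a zero entry drop out, as `μ 0 = 0`; the estimates of
  -- `multiplePoints` assume `d > 0`.
  have hzero : ∀ d : Fin r → ℕ, (¬ ∀ i, 0 < d i) → ∏ i, (moebius (d i) : ℝ) = 0 := by
    intro d hd
    push Not at hd
    obtain ⟨i, hi⟩ := hd
    exact Finset.prod_eq_zero (Finset.mem_univ i) (by simp [Nat.le_zero.1 hi])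
  refine tendsto_tsum_of_dominated_convergence hbound (fun d => ?_)
    (Eventually.of_forall fun T d => ?_)
  · rw [Finset.prod_mul_distrib]
    by_cases hd : ∀ i, 0 < d i
    · simp_rw [← inv_pow, Finset.prod_pow]
      exact ((tendsto_card_multiplePoints_div hw hd).pow 2).const_mul _
    · simp [hzero d hd]
  · by_cases hd : ∀ i, 0 < d i
    · have hD : (0 : ℝ) < ∏ i, (d i : ℝ) := Finset.prod_pos fun i _ => by exact_mod_cast hd i
      have h : ((multiplePoints w T d).card : ℝ) * ∏ i, (d i : ℝ) ≤ (simplexPoints w T).card := by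
        exact_mod_cast card_multiplePoints_mul_le hw T d
      have hq : ((multiplePoints w T d).card : ℝ) / ((simplexPoints w T).card : ℝ)
          ≤ ∏ i, (d i : ℝ)⁻¹ := by
        rw [Finset.prod_inv_distrib]
        refine div_le_of_le_mul₀ (Nat.cast_nonneg _) (by positivity) ?_
        rwa [inv_mul_eq_div, le_div_iff₀ hD]
      rw [norm_mul, norm_prod, Real.norm_of_nonneg (by positivity)]
      simp_rw [← inv_pow, Finset.prod_pow]
      refine (mul_le_of_le_one_left (by positivity)
        (Finset.prod_le_one (fun _ _ => norm_nonneg _) fun i _ => hle (d i))).trans ?_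
      gcongr
    · rw [hzero d hd, zero_mul, norm_zero]
      positivity

open ArithmeticFunction in
theorem ofReal_tsum_moebius_div_sq :
    ((∑' d : ℕ, (moebius d : ℝ) * ((d : ℝ) ^ 2)⁻¹ : ℝ) : ℂ) = (riemannZeta 2)⁻¹ := by
  have h2 : (1 : ℝ) < (2 : ℂ).re := by norm_num
  have h := LSeries_one_mul_Lseries_moebius h2
  rw [LSeries_one_eq_riemannZeta h2] at h
  rw [← eq_inv_of_mul_eq_one_right h, Complex.ofReal_tsum, LSeries]
  refine tsum_congr fun d => ?_
  rcases eq_or_ne d 0 with rfl | hd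
  · simp
  · rw [LSeries.term_of_ne_zero hd]
    simp [div_eq_mul_inv]

/-! ### Integers with a prescribed set of prime factors -/

section PrimeExponents

variable {r : ℕ} {p : Fin r → ℕ}

theorem factorization_prod_pow (hp : ∀ i, (p i).Prime) (hinj : Function.Injective p)
    (a : Fin r → ℕ) (j : Fin r) : (∏ i, p i ^ a i).factorization (p j) = a j := by
  rw [Nat.factorization_prod fun i _ => pow_ne_zero _ (hp i).ne_zero, Finset.sum_apply',
    Finset.sum_eq_single j]
  · simp [(hp j).factorization_self]
  · intro i _ hij
    simp [(hp i).factorization, hinj.ne hij]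
  · simp

theorem primeFactors_prod_pow (hp : ∀ i, (p i).Prime) {a : Fin r → ℕ} (ha : ∀ i, 1 ≤ a i) :
    (∏ i, p i ^ a i).primeFactors = Finset.univ.image p := by
  ext q
  simp only [Finset.mem_image, Finset.mem_univ, true_and]
  constructor
  · intro hq
    have hq' := Nat.prime_of_mem_primeFactors hq
    obtain ⟨i, -, hi⟩ := (hq'.prime.dvd_finsetProd_iff _).1 (Nat.dvd_of_mem_primeFactors hq)
    exact ⟨i, ((Nat.prime_dvd_prime_iff_eq hq' (hp i)).1 (hq'.dvd_of_dvd_pow hi)).symm⟩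
  · rintro ⟨i, rfl⟩
    refine Nat.mem_primeFactors.2 ⟨hp i, ?_, Finset.prod_ne_zero_iff.2 fun i _ =>
      pow_ne_zero _ (hp i).ne_zero⟩
    exact (dvd_pow_self _ (Nat.one_le_iff_ne_zero.1 (ha i))).trans
      (Finset.dvd_prod_of_mem _ (Finset.mem_univ i))

theorem kernelSet_eq_image (hp : ∀ i, (p i).Prime) (hinj : Function.Injective p) {x : ℝ}
    (hx : 0 < x) :
    kernelSet p x = (simplexPoints (fun i => Real.log (p i)) (Real.log x)).image
      fun a => ∏ i, p i ^ a i := by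
  have hw : ∀ i, 0 < Real.log (p i) := fun i => Real.log_pos (by exact_mod_cast (hp i).one_lt)
  have hlog : ∀ a : Fin r → ℕ,
      ∑ i, a i * Real.log (p i) ≤ Real.log x ↔ ((∏ i, p i ^ a i : ℕ) : ℝ) ≤ x := by
    intro a
    have hpos : (0 : ℝ) < ((∏ i, p i ^ a i : ℕ) : ℝ) := by
      exact_mod_cast Finset.prod_pos fun i _ => pow_pos (hp i).pos _
    rw [← Real.log_le_log_iff hpos hx, Nat.cast_prod, Real.log_prod fun i _ => by
      exact_mod_cast pow_ne_zero _ (hp i).ne_zero]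
    simp
  ext n
  simp only [kernelSet, Finset.mem_filter, Finset.mem_Icc, Finset.mem_image, mem_simplexPoints hw,
    hlog]
  constructor
  · rintro ⟨⟨h1, hn⟩, hrad⟩
    have hn0 : n ≠ 0 := Nat.one_le_iff_ne_zero.1 h1
    have hpf : n.primeFactors = Finset.univ.image p := by
      rw [← Nat.primeFactors_radical, hrad]
      simpa using primeFactors_prod_pow hp (a := fun _ => 1) fun _ => le_rfl
    have hprod : ∏ i, p i ^ n.factorization (p i) = n := by
      conv_rhs => rw [← Nat.prod_factorization_pow_eq_self hn0]
      rw [Finsupp.prod, Nat.support_factorization, hpf, Finset.prod_image fun i _ j _ h => hinj h]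
    refine ⟨fun i => n.factorization (p i), ⟨fun i => ?_, ?_⟩, hprod⟩
    · have hi : p i ∈ n.primeFactors := hpf ▸ Finset.mem_image_of_mem p (Finset.mem_univ i)
      exact (hp i).factorization_pos_of_dvd hn0 (Nat.dvd_of_mem_primeFactors hi)
    · rw [hprod]
      exact (Nat.le_floor_iff hx.le).1 hn
  · rintro ⟨a, ⟨h1, hle⟩, rfl⟩
    refine ⟨⟨Finset.prod_pos fun i _ => pow_pos (hp i).pos _, Nat.le_floor hle⟩, ?_⟩
    rw [Nat.radical_eq_prod_primeFactors, primeFactors_prod_pow hp h1,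
      Finset.prod_image fun i _ j _ h => hinj h]

theorem prod_pow_injective (hp : ∀ i, (p i).Prime) (hinj : Function.Injective p) :
    Function.Injective fun a : Fin r → ℕ => ∏ i, p i ^ a i := fun a b h => by
  funext j
  rw [← factorization_prod_pow hp hinj a j, ← factorization_prod_pow hp hinj b j]
  exact congrArg (fun n => n.factorization (p j)) h

theorem exponentiallyCoprime_prod_pow_iff (hp : ∀ i, (p i).Prime) (hinj : Function.Injective p)
    {a b : Fin r → ℕ} (ha : ∀ i, 1 ≤ a i) (hb : ∀ i, 1 ≤ b i) :
    ExponentiallyCoprime (∏ i, p i ^ a i) (∏ i, p i ^ b i) ↔ ∀ i, (a i).Coprime (b i) := by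
  have hpos : ∀ c : Fin r → ℕ, 0 < ∏ i, p i ^ c i := fun c =>
    Finset.prod_pos fun i _ => pow_pos (hp i).pos _
  simp [ExponentiallyCoprime, hpos, primeFactors_prod_pow hp ha, primeFactors_prod_pow hp hb,
    factorization_prod_pow hp hinj]

theorem kernelCount_eq (hp : ∀ i, (p i).Prime) (hinj : Function.Injective p) {x : ℝ}
    (hx : 0 < x) :
    kernelCount p x = (simplexPoints (fun i => Real.log (p i)) (Real.log x)).card := by
  rw [kernelCount, kernelSet_eq_image hp hinj hx,
    Finset.card_image_of_injective _ (prod_pow_injective hp hinj)]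

theorem expCoprimePairCount_eq (hp : ∀ i, (p i).Prime) (hinj : Function.Injective p) {x : ℝ}
    (hx : 0 < x) :
    expCoprimePairCount p x = ((simplexPoints (fun i => Real.log (p i)) (Real.log x) ×ˢ
      simplexPoints (fun i => Real.log (p i)) (Real.log x)).filter
        fun q => ∀ i, (q.1 i).Coprime (q.2 i)).card := by
  have hw : ∀ i, 0 < Real.log (p i) := fun i => Real.log_pos (by exact_mod_cast (hp i).one_lt)
  have hI := prod_pow_injective hp hinj
  rw [expCoprimePairCount, kernelSet_eq_image hp hinj hx, ← Finset.prodMap_image_product,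
    Finset.filter_image, Finset.card_image_of_injective _ (hI.prodMap hI)]
  refine congrArg Finset.card (Finset.filter_congr fun q hq => ?_)
  rw [Finset.mem_product, mem_simplexPoints hw, mem_simplexPoints hw] at hq
  exact exponentiallyCoprime_prod_pow_iff hp hinj hq.1.1 hq.2.1

end PrimeExponents

theorem corollary2 (r : ℕ) (hr : 1 ≤ r) (p : Fin r → ℕ) (hp : ∀ i, (p i).Prime)
    (hinj : Function.Injective p) :
    Tendsto
      (fun x : ℝ => (((expCoprimePairCount p x : ℝ) / (kernelCount p x : ℝ) ^ 2 : ℝ) : ℂ))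
      atTop (𝓝 (((riemannZeta 2) ^ r)⁻¹)) := by
  have hw : ∀ i, 0 < Real.log (p i) := fun i => Real.log_pos (by exact_mod_cast (hp i).one_lt)
  rw [← inv_pow, ← ofReal_tsum_moebius_div_sq, ← Complex.ofReal_pow]
  refine (Complex.continuous_ofReal.tendsto _).comp
    (((tendsto_coprime_pairs_density hw).comp Real.tendsto_log_atTop).congr' ?_)
  filter_upwards [eventually_gt_atTop 0] with x hx
  rw [kernelCount_eq hp hinj hx, expCoprimePairCount_eq hp hinj hx, Function.comp_apply]
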